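/- Let $G$ be a finitely generated torsion-free nilpotent group with rational closure $\overline{G}$, i.e. $\overline{G}$ is a torsion-free nilpotent group containing $G$ such that for all $h\in\overline{G}$ and every positive integer $n$ there is a unique $k\in\overline{G}$ with $k^n=h$, and every $h\in\overline{G}$ has a positive power in $G$. A subgroup $H\le\overline{G}$ is called rational if $k\in H$ whenever $k\in\overline{G}$ and $k^n\in H$ for some positive integer $n$; a rational subgroup is rationally indecomposable if it is not the internal direct product of two nontrivial rational subgroups. Suppose that $\overline{G}$ has two decompositions as an internal direct product $$\overline{G}=R_1\times R_2\times\cdots\times R_m=K_1\times K_2\times\cdots\times K_m$$ of nontrivial, rationally indecomposable rational subgroups. Let $\alpha_i$ be the projection of $\overline{G}$ onto $R_i$ in the first decomposition, and $\beta_i$ the projection of $\overline{G}$ onto $K_i$ in the second. Suppose that the factors are ordered so that for every $1\le i\le m$: 1. $\alpha_i(K_i)=R_i$, and the restriction of $\alpha_i$ to $K_i$ is an isomorphism from $K_i$ to $R_i$ whose inverse is the restriction of $\beta_i$ to $R_i$; and 2. $\overline{G}=R_1\times\cdots\times R_{i-1}\times K_i\times R_{i+1}\times\cdots\times R_m$.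 Then $K_i\,Z(\overline{G})=R_i\,Z(\overline{G})$ for every $1\le i\le m$, where $Z(\overline{G})$ is the center of $\overline{G}$. -/

import Mathlib

open scoped Pointwise

namespace RationalClosure

/-- The only element of finite order is the identity. -/
def TorsionFree (G : Type*) [Group G] : Prop :=
  ∀ g : G, IsOfFinOrder g → g = 1

/-- The embedding `e : G →* Γ` exhibits `Γ` as a rational closure (Malcev completion) of `G`:
`Γ` is a torsion-free nilpotent group with unique roots in which every element has a positive power
lying in (the image of) `G`. -/
structure IsRationalClosure {G Γ : Type*} [Group G] [Group Γ] (e : G →* Γ) : Prop where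
  injective : Function.Injective e
  nilpotent : Group.IsNilpotent Γ
  torsionFree : TorsionFree Γ
  existsUnique_root : ∀ (h : Γ) (n : ℕ), 0 < n → ∃! k : Γ, k ^ n = h
  exists_pow_mem : ∀ h : Γ, ∃ n : ℕ, 0 < n ∧ h ^ n ∈ e.range

/-- A subgroup is rational if it contains all roots of its elements. -/
def IsRationalSubgroup {Γ : Type*} [Group Γ] (H : Subgroup Γ) : Prop :=
  ∀ (k : Γ) (n : ℕ), 0 < n → k ^ n ∈ H → k ∈ H

/-- The subgroup `P` is the internal direct product `A × B` of the subgroups `A` and `B`. -/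
structure IsDirectProductOfTwo {Γ : Type*} [Group Γ] (P A B : Subgroup Γ) : Prop where
  commute : ∀ a ∈ A, ∀ b ∈ B, Commute a b
  inf_eq_bot : A ⊓ B = ⊥
  sup_eq : A ⊔ B = P

/-- `P` is not the internal direct product of two nontrivial rational subgroups. -/
def IsRationallyIndecomposable {Γ : Type*} [Group Γ] (P : Subgroup Γ) : Prop :=
  ∀ A B : Subgroup Γ, IsRationalSubgroup A → IsRationalSubgroup B →
    IsDirectProductOfTwo P A B → A = ⊥ ∨ B = ⊥

/-- `Γ` is the internal direct product of the finite family of subgroups `A i`: elements of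
different members commute, and the multiplication map `∏ A i → Γ` is bijective. -/
structure IsInternalDirectProduct {Γ : Type*} [Group Γ] {ι : Type*} [Fintype ι]
    (A : ι → Subgroup Γ) : Prop where
  commute : Pairwise fun i j : ι => ∀ x y : Γ, x ∈ A i → y ∈ A j → Commute x y
  bijective : Function.Bijective (Subgroup.noncommPiCoprod commute)

/-- The projection of `Γ` onto the `i`-th factor of an internal direct product decomposition. -/
noncomputable def IsInternalDirectProduct.proj {Γ : Type*} [Group Γ] {ι : Type*} [Fintype ι]
    {A : ι → Subgroup Γ} (h : IsInternalDirectProduct A) (i : ι) : Γ →* A i :=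
  (Pi.evalMonoidHom (fun j => A j) i).comp
    (MulEquiv.ofBijective (Subgroup.noncommPiCoprod h.commute) h.bijective).symm.toMonoidHom

/-- A decomposition of `Γ` as a direct product of nontrivial rational subgroups which are
rationally indecomposable. -/
structure IsIndecomposableDecomposition {Γ : Type*} [Group Γ] {ι : Type*} [Fintype ι]
    (A : ι → Subgroup Γ) : Prop where
  isProduct : IsInternalDirectProduct A
  rational : ∀ i, IsRationalSubgroup (A i)
  ne_bot : ∀ i, A i ≠ ⊥
  indecomposable : ∀ i, IsRationallyIndecomposable (A i)

/-- The two decompositions `R` and `K` (with projections `α i` and `β i`) are compatibly ordered: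
for each `i`, `α i` maps `K i` onto `R i`, its restriction to `K i` is an isomorphism onto `R i`
whose inverse is the restriction of `β i` to `R i`, and `R i` can be exchanged for `K i`. -/
structure CompatiblyOrdered {Γ : Type*} [Group Γ] {ι : Type*} [Fintype ι] [DecidableEq ι]
    {R K : ι → Subgroup Γ} (hR : IsInternalDirectProduct R) (hK : IsInternalDirectProduct K) :
    Prop where
  map_eq : ∀ i, ((K i).map (hR.proj i)).map (R i).subtype = R i
  left_inv : ∀ i, ∀ x : K i, hK.proj i (hR.proj i (x : Γ) : Γ) = x
  right_inv : ∀ i, ∀ y : R i, hR.proj i (hK.proj i (y : Γ) : Γ) = y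
  exchange : ∀ i, IsInternalDirectProduct (Function.update R i (K i))

end RationalClosure

/-! By the exchange property, `K i` centralizes every `R j` with `j ≠ i`. For `x ∈ K i`, the
quotient of `x` by its `R i`-component then centralizes these `R j` and has trivial `R i`-component,
so it is central (`inv_proj_mul_mem_center`). Hence `K i ⊆ R i · Z`; the reverse inclusion follows
because each `y ∈ R i` is the `R i`-component of its own projection to `K i`. -/

namespace RationalClosure.IsInternalDirectProduct

variable {Γ : Type*} [Group Γ] {ι : Type*} [Fintype ι] {A : ι → Subgroup Γ}

theorem ext_proj (h : IsInternalDirectProduct A) {x y : Γ}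
    (hxy : ∀ i, h.proj i x = h.proj i y) : x = y :=
  (MulEquiv.ofBijective (Subgroup.noncommPiCoprod h.commute) h.bijective).symm.injective
    (funext hxy)

variable [DecidableEq ι]

theorem symm_coe (h : IsInternalDirectProduct A) (i : ι) (a : A i) :
    (MulEquiv.ofBijective (Subgroup.noncommPiCoprod h.commute) h.bijective).symm (a : Γ) =
      (Pi.mulSingle i a : ∀ j, A j) := by
  rw [MulEquiv.symm_apply_eq]
  exact (Subgroup.noncommPiCoprod_mulSingle (hcomm := h.commute) i a).symm

theorem proj_coe_self (h : IsInternalDirectProduct A) (i : ι) (a : A i) :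
    h.proj i (a : Γ) = a :=
  (congrFun (h.symm_coe i a) i).trans (Pi.mulSingle_eq_same (M := fun j => A j) i a)

/-- An element commuting with every factor but the `i`-th agrees with its projection to the `i`-th
factor modulo the center. -/
theorem inv_proj_mul_mem_center (h : IsInternalDirectProduct A) (i : ι) {x : Γ}
    (hx : ∀ j, j ≠ i → ∀ r ∈ A j, Commute x r) :
    ((h.proj i x : Γ))⁻¹ * x ∈ Subgroup.center Γ := by
  rw [Subgroup.mem_center_iff]
  intro g
  refine h.ext_proj fun j => ?_
  rw [map_mul _ g, map_mul _ _ g]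
  by_cases hj : j = i
  · subst hj
    rw [map_mul, map_inv, h.proj_coe_self, inv_mul_cancel, one_mul, mul_one]
  -- Only the component of `g` in `A j` matters here, and `h.proj j` fixes it, so commutation in `Γ`
  -- passes to the `j`-th coordinates.
  · have hc : Commute ((h.proj i x : Γ)⁻¹ * x) (h.proj j g : Γ) :=
      (h.commute (Ne.symm hj) _ _ (h.proj i x).2 (h.proj j g).2).inv_left.mul_left
        (hx j hj _ (h.proj j g).2)
    have hc' := hc.map (h.proj j)
    rw [h.proj_coe_self] at hc'
    exact hc'.eq.symm

end RationalClosure.IsInternalDirectProduct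

theorem mainTheorem4 {G Γ : Type*} [Group G] [Group Γ]
    (hfg : Group.FG G) (hnil : Group.IsNilpotent G) (htf : RationalClosure.TorsionFree G)
    (e : G →* Γ) (he : RationalClosure.IsRationalClosure e)
    (m : ℕ) (R K : Fin m → Subgroup Γ)
    (hR : RationalClosure.IsIndecomposableDecomposition R)
    (hK : RationalClosure.IsIndecomposableDecomposition K)
    (hRK : RationalClosure.CompatiblyOrdered hR.isProduct hK.isProduct) :
    ∀ i : Fin m,
      (K i : Set Γ) * (Subgroup.center Γ : Set Γ) = (R i : Set Γ) * (Subgroup.center Γ : Set Γ) := by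
  intro i
  have key : ∀ x ∈ K i, ((hR.isProduct.proj i x : Γ))⁻¹ * x ∈ Subgroup.center Γ := by
    intro x hx
    refine hR.isProduct.inv_proj_mul_mem_center i fun j hj r hr => ?_
    exact (hRK.exchange i).commute (Ne.symm hj) x r (by simpa using hx) (by simpa [hj] using hr)
  ext g
  simp only [Set.mem_mul, SetLike.mem_coe]
  constructor
  · rintro ⟨x, hx, z, hz, rfl⟩
    exact ⟨_, (hR.isProduct.proj i x).2, _, mul_mem (key x hx) hz, by group⟩
  · rintro ⟨y, hy, z, hz, rfl⟩
    -- Take `x` to be the projection of `y` to `K i`: its `R i`-component is `y` by `right_inv`.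
    have hk := key _ (hK.isProduct.proj i y).2
    rw [hRK.right_inv i ⟨y, hy⟩] at hk
    exact ⟨_, (hK.isProduct.proj i y).2, _, mul_mem (inv_mem hk) hz, by group⟩
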